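/- **Setting.** Let $\Omega\subset\mathbb R^n$ be open and bounded, and let $\Gamma\subset\partial\Omega$ be measurable with surface measure $0<\sigma(\Gamma)<\infty$, where $\sigma$ is the $(n-1)$-dimensional Hausdorff measure. Let $X_2=H^{1/2}(\Gamma)$ be the real Hilbert space of all $f\in L^2(\Gamma)$ with finite norm $$\|f\|^2=\int_\Gamma |f|^2\,d\sigma+\iint_{\Gamma\times\Gamma}\frac{|f(\xi)-f(\eta)|^2}{|\xi-\eta|^{n}}\,d\sigma(\xi)\,d\sigma(\eta).$$ Let $Y$ be a real Hilbert space, the space of measured states ($Y=\mathbb R^q$ for $q$ sensors). Let $A_{11}:Y\to Y$, $A_{12}:X_2\to Y$, $A_{21}:Y\to X_2$, $A_{22}:X_2\to X_2$ be linear operators, possibly unbounded, with domains $D(A_{ij})$ that include the boundary conditions. Let $B_1:\mathbb R^p\to Y$ and $B_2:\mathbb R^p\to X_2$ be bounded linear operators. Consider the system $$x_1'=A_{11}x_1+A_{12}x_2+B_1u,\qquad x_2'=A_{21}x_1+A_{22}x_2+B_2u,\qquad y=x_1,$$ and assume that its block operator $A$, with domain $(D(A_{11})\cap D(A_{21}))\times(D(A_{12})\cap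 D(A_{22}))$, generates a strongly continuous semigroup on $Y\times X_2$. For the unmeasured part $x_2$ this gives the reduced system $$a'=A_{22}a+[B_2u+A_{21}y],\qquad \tilde y=A_{12}a\qquad(a=x_2).$$ For a bounded operator $H:Y\to X_2$, the operator $A_{22}-HA_{12}$ has domain $D(A_{22})\cap D(A_{12})$. Call $H$ *stabilizing*, with semigroup $S$ and constants $M,\alpha>0$, if $A_{22}-HA_{12}$ generates a strongly continuous semigroup $S$ on $H^{1/2}(\Gamma)$ with $\|S(t)\|\le Me^{-\alpha t}$ for $t\ge0$. The reduced system is *$\Gamma_{ER}$-detectable* if a stabilizing $H$ exists. Consider the estimators $$\hat z'=A_{22}\hat z+[B_2u+A_{21}y]+H(\tilde y-A_{12}\hat z),\qquad \tilde y=A_{12}x_2,\tag{E}$$ $$\varphi'=(A_{22}-HA_{12})\varphi+Ky+(B_2-HB_1)u,\tag{R}$$ where (R) is used when $H$ maps $D(A_{11})\cap D(A_{21})$ into $D(A_{22})\cap D(A_{12})$ and the operator $A_{22}H-HA_{12}H-HA_{11}+A_{21}$, defined on $D(A_{11})\cap D(A_{21})$, is the restriction of a bounded operator $K:Y\to X_2$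 ("$H$ has a bounded coefficient $K$"). For (E), trajectories of the system and of the estimator are classical solutions: continuous on $[0,\infty)$ and satisfying the equations for all $t>0$. For (R), the system and the estimator are solved in the mild sense (variation of constants), with arbitrary initial data and arbitrary locally integrable $u:[0,\infty)\to\mathbb R^p$. **Theorem 5.12.** Suppose that the reduced system is $\Gamma_{ER}$-detectable. 1. The system is $\Gamma_{ER}$-observable through (E): there are a bounded $H$ and constants $M,\alpha>0$ such that along every trajectory $(x_1,x_2)$ of the system (E) has a solution from every initial value $\hat z_0$ with $\hat z_0-x_2(0)\in D(A_{22}-HA_{12})$, and every solution satisfies $\|\hat z(t)-x_2(t)\|_{H^{1/2}(\Gamma)}\le Me^{-\alpha t}\|\hat z(0)-x_2(0)\|_{H^{1/2}(\Gamma)}$ for $t\ge0$. 2. If some stabilizing gain has a bounded coefficient, the system is $\Gamma_{ER}$-observable through the reduced estimator (R): there are bounded $H,K$, with $K$ the bounded coefficient of $H$ and $A_{22}-HA_{12}$ the generator of a strongly continuous semigroup, and constants $M,\alpha>0$ such that for all initial data and inputs (R) has a solution and every solution satisfies $$\|\varphi(t)+Hy(t)-x_2(t)\|_{H^{1/2}(\Gamma)}\le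 Me^{-\alpha t}\|\varphi(0)+Hy(0)-x_2(0)\|_{H^{1/2}(\Gamma)},\qquad t\ge0.$$ 3. More precisely, let $H$ be any stabilizing gain, with semigroup $S$ and constants $M,\alpha$. Then the statement on (E) in 1 holds with these $H,M,\alpha$, and for every solution $\hat z$ of (E) the error $e=\hat z-x_2$ takes values in $D(A_{22}-HA_{12})$ for $t>0$ and satisfies $e'(t)=(A_{22}-HA_{12})e(t)$ for $t>0$, $e(t)=S(t)e(0)$ for $t\ge0$, and $\lim_{t\to\infty}\|e(t)\|_{H^{1/2}(\Gamma)}=0$. If $H$ has a bounded coefficient $K$, then the statement on (R) in 2 holds with these $H,K,M,\alpha$, and $e=\varphi+Hy-x_2$ satisfies $e(t)=S(t)e(0)$ for $t\ge0$ and $$\lim_{t\to\infty}\|\varphi(t)+Hy(t)-x_2(t)\|_{H^{1/2}(\Gamma)}=0.$$ -/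

import Mathlib

open Set Filter Topology MeasureTheory
open scoped ENNReal

noncomputable section

namespace RegionalObs

/-! ### The space `H^{1/2}` of a region of the boundary -/

/-- Surface measure on a region `Γ` of the boundary of a domain of `ℝⁿ`: the
`(n-1)`-dimensional Hausdorff measure restricted to `Γ`. -/
def surfaceMeasure {n : ℕ} (Γ : Set (EuclideanSpace ℝ (Fin n))) :
    Measure (EuclideanSpace ℝ (Fin n)) :=
  (μH[(n : ℝ) - 1] : Measure (EuclideanSpace ℝ (Fin n))).restrict Γ

/-- The measure `|ξ - η|^{-n} dσ(ξ) dσ(η)` on `Γ × Γ`. The exponent is `(n - 1) + 2 s` with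
`s = 1/2`. -/
def gagliardoMeasure {n : ℕ} (Γ : Set (EuclideanSpace ℝ (Fin n))) :
    Measure (EuclideanSpace ℝ (Fin n) × EuclideanSpace ℝ (Fin n)) :=
  ((surfaceMeasure Γ).prod (surfaceMeasure Γ)).withDensity
    fun z => ENNReal.ofReal ((dist z.1 z.2 ^ n)⁻¹)

section Slobodeckij

variable {n : ℕ} (Γ : Set (EuclideanSpace ℝ (Fin n)))

theorem fst_quasi :
    Measure.QuasiMeasurePreserving Prod.fst (gagliardoMeasure Γ) (surfaceMeasure Γ) :=
  Measure.quasiMeasurePreserving_fst.mono_left (withDensity_absolutelyContinuous _ _)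

theorem snd_quasi :
    Measure.QuasiMeasurePreserving Prod.snd (gagliardoMeasure Γ) (surfaceMeasure Γ) :=
  Measure.quasiMeasurePreserving_snd.mono_left (withDensity_absolutelyContinuous _ _)

/-- The pairs `(f, g)` in `L²(σ) × L²(|ξ - η|^{-n} σ ⊗ σ)` with `g (ξ, η) = f ξ - f η` almost
everywhere. -/
def sobolevHalfSubmodule :
    Submodule ℝ (WithLp 2 (Lp ℝ 2 (surfaceMeasure Γ) × Lp ℝ 2 (gagliardoMeasure Γ))) where
  carrier := {w | ∀ᵐ z ∂(gagliardoMeasure Γ), w.snd z = w.fst z.1 - w.fst z.2}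
  zero_mem' := by
    have h0 := Lp.coeFn_zero ℝ 2 (surfaceMeasure Γ)
    have hg := Lp.coeFn_zero ℝ 2 (gagliardoMeasure Γ)
    have h1 := (fst_quasi Γ).ae h0
    have h2 := (snd_quasi Γ).ae h0
    filter_upwards [hg, h1, h2] with z a b c
    simp only [WithLp.zero_fst, WithLp.zero_snd]
    rw [a, b, c]
    simp
  add_mem' := by
    intro v w hv hw
    have h0 := Lp.coeFn_add v.fst w.fst
    have hg := Lp.coeFn_add v.snd w.snd
    have h1 := (fst_quasi Γ).ae h0
    have h2 := (snd_quasi Γ).ae h0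
    filter_upwards [hv, hw, hg, h1, h2] with z p q a b c
    simp only [WithLp.add_fst, WithLp.add_snd] at *
    rw [a, b, c]
    simp only [Pi.add_apply]
    rw [p, q]
    ring
  smul_mem' := by
    intro r w hw
    have h0 := Lp.coeFn_smul r w.fst
    have hg := Lp.coeFn_smul r w.snd
    have h1 := (fst_quasi Γ).ae h0
    have h2 := (snd_quasi Γ).ae h0
    filter_upwards [hw, hg, h1, h2] with z q a b c
    simp only [WithLp.smul_fst, WithLp.smul_snd] at *
    rw [a, b, c]
    simp only [Pi.smul_apply, smul_eq_mul]
    rw [q]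
    ring

/-- The Hilbert space `H^{1/2}(Γ)`: the `f ∈ L²(Γ)` for which
`∬ |f ξ - f η|² / |ξ - η|^n dσ(ξ) dσ(η)` is finite, with the norm
`‖f‖² = ∫ |f|² dσ + ∬ |f ξ - f η|² / |ξ - η|^n dσ(ξ) dσ(η)`. It is realised through
`f ↦ (f, f ξ - f η)`. -/
abbrev SobolevHalf : Type := sobolevHalfSubmodule Γ

theorem isClosed_sobolevHalfSubmodule :
    IsClosed (sobolevHalfSubmodule Γ :
      Set (WithLp 2 (Lp ℝ 2 (surfaceMeasure Γ) × Lp ℝ 2 (gagliardoMeasure Γ)))) := by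
  refine IsSeqClosed.isClosed ?_
  intro w v hw hv
  have hc1 : Tendsto (fun k => (w k).fst) atTop (𝓝 v.fst) :=
    ((WithLp.continuous_fst _ _ _).tendsto v).comp hv
  have hc2 : Tendsto (fun k => (w k).snd) atTop (𝓝 v.snd) :=
    ((WithLp.continuous_snd _ _ _).tendsto v).comp hv
  obtain ⟨a, ha, hfa⟩ := (tendstoInMeasure_of_tendsto_Lp hc1).exists_seq_tendsto_ae
  have hc2' := hc2.comp ha.tendsto_atTop
  obtain ⟨b, hb, hfb⟩ := (tendstoInMeasure_of_tendsto_Lp hc2').exists_seq_tendsto_ae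
  have hw' : ∀ᵐ z ∂(gagliardoMeasure Γ), ∀ k, (w k).snd z = (w k).fst z.1 - (w k).fst z.2 :=
    ae_all_iff.2 hw
  filter_upwards [hw', hfb, (fst_quasi Γ).ae hfa, (snd_quasi Γ).ae hfa] with z h1 h2 h3 h4
  refine tendsto_nhds_unique h2 ?_
  have h5 := (h3.sub h4).comp hb.tendsto_atTop
  refine h5.congr fun k => ?_
  simp [h1]

instance : CompleteSpace (SobolevHalf Γ) :=
  (isClosed_sobolevHalfSubmodule Γ).completeSpace_coe

end Slobodeckij

/-! ### Strongly continuous semigroups -/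

section Semigroup

variable {X : Type*} [NormedAddCommGroup X] [NormedSpace ℝ X]

/-- `(S t)_{t ≥ 0}` is a strongly continuous semigroup of bounded operators (the values at
`t < 0` are irrelevant). -/
structure IsC0Semigroup (S : ℝ → X →L[ℝ] X) : Prop where
  map_zero : S 0 = ContinuousLinearMap.id ℝ X
  map_add : ∀ s t : ℝ, 0 ≤ s → 0 ≤ t → S (s + t) = (S s).comp (S t)
  continuousOn : ∀ x : X, ContinuousOn (fun t => S t x) (Ici 0)

/-- The unbounded operator `A`, with its domain, is the infinitesimal generator of `S`. -/
def IsGenerator (A : X →ₗ.[ℝ] X) (S : ℝ → X →L[ℝ] X) : Prop :=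
  ∀ x y : X, (x, y) ∈ A.graph ↔
    Tendsto (fun h : ℝ => h⁻¹ • (S h x - x)) (𝓝[>] 0) (𝓝 y)

/-- `x` is the mild solution on `[0, ∞)` of `x' = A x + f`, `x 0 = x₀`, where `A` generates `S`:
`x t = S t x₀ + ∫₀ᵗ S (t - τ) (f τ) dτ`. -/
def IsMildSolution (S : ℝ → X →L[ℝ] X) (x₀ : X) (f x : ℝ → X) : Prop :=
  ∀ t : ℝ, 0 ≤ t →
    IntervalIntegrable (fun τ => S (t - τ) (f τ)) volume 0 t ∧
    x t = S t x₀ + ∫ τ in (0 : ℝ)..t, S (t - τ) (f τ)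

end Semigroup

/-! ### The partitioned system -/

/-- The operators of a linear system on `Y × X₂` with control in `ℝᵖ`,
`x₁' = A₁₁ x₁ + A₁₂ x₂ + B₁ u`, `x₂' = A₂₁ x₁ + A₂₂ x₂ + B₂ u`,
whose first component is measured, `y = x₁`. The `Aᵢⱼ` are unbounded operators with
their domains (boundary conditions are part of the domains). -/
structure PartitionedSystem (p : ℕ) (Y X₂ : Type*)
    [NormedAddCommGroup Y] [InnerProductSpace ℝ Y]
    [NormedAddCommGroup X₂] [InnerProductSpace ℝ X₂] where
  A₁₁ : Y →ₗ.[ℝ] Y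
  A₁₂ : X₂ →ₗ.[ℝ] Y
  A₂₁ : Y →ₗ.[ℝ] X₂
  A₂₂ : X₂ →ₗ.[ℝ] X₂
  B₁ : EuclideanSpace ℝ (Fin p) →L[ℝ] Y
  B₂ : EuclideanSpace ℝ (Fin p) →L[ℝ] X₂

namespace PartitionedSystem

variable {p : ℕ} {Y X₂ : Type*} [NormedAddCommGroup Y] [InnerProductSpace ℝ Y]
  [NormedAddCommGroup X₂] [InnerProductSpace ℝ X₂] (P : PartitionedSystem p Y X₂)

/-- The block operator `A (x₁, x₂) = (A₁₁ x₁ + A₁₂ x₂, A₂₁ x₁ + A₂₂ x₂)` on its natural domain. -/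
def blockOp : (Y × X₂) →ₗ.[ℝ] (Y × X₂) where
  domain := (P.A₁₁.domain ⊓ P.A₂₁.domain).prod (P.A₁₂.domain ⊓ P.A₂₂.domain)
  toFun :=
    { toFun := fun w =>
        (P.A₁₁ ⟨w.1.1, w.2.1.1⟩ + P.A₁₂ ⟨w.1.2, w.2.2.1⟩,
          P.A₂₁ ⟨w.1.1, w.2.1.2⟩ + P.A₂₂ ⟨w.1.2, w.2.2.2⟩)
      map_add' := by
        rintro ⟨⟨a, b⟩, ⟨h1, h2⟩, h3, h4⟩ ⟨⟨c, d⟩, ⟨k1, k2⟩, k3, k4⟩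
        have e1 := P.A₁₁.map_add ⟨a, h1⟩ ⟨c, k1⟩
        have e2 := P.A₂₁.map_add ⟨a, h2⟩ ⟨c, k2⟩
        have e3 := P.A₁₂.map_add ⟨b, h3⟩ ⟨d, k3⟩
        have e4 := P.A₂₂.map_add ⟨b, h4⟩ ⟨d, k4⟩
        exact Prod.ext
          ((congrArg₂ (· + ·) e1 e3).trans (add_add_add_comm _ _ _ _))
          ((congrArg₂ (· + ·) e2 e4).trans (add_add_add_comm _ _ _ _))
      map_smul' := by
        rintro r ⟨⟨a, b⟩, ⟨h1, h2⟩, h3, h4⟩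
        have e1 := P.A₁₁.map_smul r ⟨a, h1⟩
        have e2 := P.A₂₁.map_smul r ⟨a, h2⟩
        have e3 := P.A₁₂.map_smul r ⟨b, h3⟩
        have e4 := P.A₂₂.map_smul r ⟨b, h4⟩
        exact Prod.ext
          ((congrArg₂ (· + ·) e1 e3).trans (smul_add _ _ _).symm)
          ((congrArg₂ (· + ·) e2 e4).trans (smul_add _ _ _).symm) }

/-- The input-to-state operator `u ↦ (B₁ u, B₂ u)`. -/
def inputOp : EuclideanSpace ℝ (Fin p) →L[ℝ] (Y × X₂) := P.B₁.prod P.B₂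

/-- `A₂₂ - H A₁₂` on the domain `D(A₂₂) ∩ D(A₁₂)`. -/
def errorOp (H : Y →L[ℝ] X₂) : X₂ →ₗ.[ℝ] X₂ :=
  P.A₂₂ - (H : Y →ₗ[ℝ] X₂).compPMap P.A₁₂

/-- `A₂₂ - H A₁₂` generates the strongly continuous semigroup `S`, and
`‖S t‖ ≤ M exp (-α t)` for `t ≥ 0`, with `M, α > 0`. -/
structure IsStabilizing (H : Y →L[ℝ] X₂) (S : ℝ → X₂ →L[ℝ] X₂) (M α : ℝ) : Prop where
  semigroup : IsC0Semigroup S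
  generator : IsGenerator (P.errorOp H) S
  M_pos : 0 < M
  α_pos : 0 < α
  bound : ∀ t : ℝ, 0 ≤ t → ‖S t‖ ≤ M * Real.exp (-α * t)

/-- The reduced system `a' = A₂₂ a + [B₂ u + A₂₁ y]`, `ỹ = A₁₂ a` is exponentially detectable:
some bounded gain `H` makes `A₂₂ - H A₁₂` the generator of an exponentially stable strongly
continuous semigroup on `X₂`. -/
def IsDetectable : Prop :=
  ∃ (H : Y →L[ℝ] X₂) (S : ℝ → X₂ →L[ℝ] X₂) (M α : ℝ), P.IsStabilizing H S M α

/-- `A₂₂ H - H A₁₂ H - H A₁₁ + A₂₁` is defined wherever `A₁₁` and `A₂₁` are, and coincides there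
with the bounded operator `K`. -/
def HasBoundedCoefficient (H K : Y →L[ℝ] X₂) : Prop :=
  ∀ (y : Y) (h₁₁ : y ∈ P.A₁₁.domain) (h₂₁ : y ∈ P.A₂₁.domain),
    ∃ (h₂₂ : H y ∈ P.A₂₂.domain) (h₁₂ : H y ∈ P.A₁₂.domain),
      K y = P.A₂₂ ⟨H y, h₂₂⟩ - H (P.A₁₂ ⟨H y, h₁₂⟩) - H (P.A₁₁ ⟨y, h₁₁⟩) + P.A₂₁ ⟨y, h₂₁⟩

/-- Classical trajectories of the system, with input `u`: continuous on `[0, ∞)`, and satisfying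
the equations for `t > 0`. -/
structure IsTrajectory (u : ℝ → EuclideanSpace ℝ (Fin p)) (x₁ : ℝ → Y) (x₂ : ℝ → X₂) :
    Prop where
  continuousOn₁ : ContinuousOn x₁ (Ici 0)
  continuousOn₂ : ContinuousOn x₂ (Ici 0)
  equation : ∀ t : ℝ, 0 < t →
    ∃ (h₁₁ : x₁ t ∈ P.A₁₁.domain) (h₁₂ : x₂ t ∈ P.A₁₂.domain)
      (h₂₁ : x₁ t ∈ P.A₂₁.domain) (h₂₂ : x₂ t ∈ P.A₂₂.domain),
      HasDerivAt x₁ (P.A₁₁ ⟨x₁ t, h₁₁⟩ + P.A₁₂ ⟨x₂ t, h₁₂⟩ + P.B₁ (u t)) t ∧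
      HasDerivAt x₂ (P.A₂₁ ⟨x₁ t, h₂₁⟩ + P.A₂₂ ⟨x₂ t, h₂₂⟩ + P.B₂ (u t)) t

/-- Classical solutions `z` of the estimator
`z' = A₂₂ z + [B₂ u + A₂₁ y] + H (ỹ - A₁₂ z)` along a trajectory `(x₁, x₂)` of the system, where
`y = x₁` and `ỹ = A₁₂ x₂`. -/
structure IsEstimate (H : Y →L[ℝ] X₂) (u : ℝ → EuclideanSpace ℝ (Fin p)) (x₁ : ℝ → Y)
    (x₂ z : ℝ → X₂) : Prop where
  continuousOn : ContinuousOn z (Ici 0)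
  equation : ∀ t : ℝ, 0 < t →
    ∃ (h₂₂ : z t ∈ P.A₂₂.domain) (h₁₂ : z t ∈ P.A₁₂.domain)
      (k₂₁ : x₁ t ∈ P.A₂₁.domain) (k₁₂ : x₂ t ∈ P.A₁₂.domain),
      HasDerivAt z (P.A₂₂ ⟨z t, h₂₂⟩ + (P.B₂ (u t) + P.A₂₁ ⟨x₁ t, k₂₁⟩) +
        H (P.A₁₂ ⟨x₂ t, k₁₂⟩ - P.A₁₂ ⟨z t, h₁₂⟩)) t

/-- The right-hand side `K y + (B₂ - H B₁) u` of the reduced estimator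
`φ' = (A₂₂ - H A₁₂) φ + K y + (B₂ - H B₁) u`. -/
def reducedForcing (H K : Y →L[ℝ] X₂) (u : ℝ → EuclideanSpace ℝ (Fin p)) (y : ℝ → Y) :
    ℝ → X₂ :=
  fun τ => K (y τ) + (P.B₂ - H.comp P.B₁) (u τ)

/-- The estimator `z' = A₂₂ z + [B₂ u + A₂₁ y] + H (ỹ - A₁₂ z)` is an exponential estimator of
`x₂`, with constants `M` and `α`: along every trajectory it can be started from any `z₀` with
`z₀ - x₂ 0 ∈ D(A₂₂ - H A₁₂)`, and every solution `z` satisfies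
`‖z t - x₂ t‖ ≤ M exp (-α t) ‖z 0 - x₂ 0‖`. -/
def IsExpEstimator (H : Y →L[ℝ] X₂) (M α : ℝ) : Prop :=
  ∀ (u : ℝ → EuclideanSpace ℝ (Fin p)) (x₁ : ℝ → Y) (x₂ : ℝ → X₂), P.IsTrajectory u x₁ x₂ →
    (∀ z₀ : X₂, z₀ - x₂ 0 ∈ (P.errorOp H).domain →
      ∃ z : ℝ → X₂, z 0 = z₀ ∧ P.IsEstimate H u x₁ x₂ z) ∧
    ∀ z : ℝ → X₂, P.IsEstimate H u x₁ x₂ z → ∀ t : ℝ, 0 ≤ t →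
      ‖z t - x₂ t‖ ≤ M * Real.exp (-α * t) * ‖z 0 - x₂ 0‖

/-- The reduced estimator `φ' = (A₂₂ - H A₁₂) φ + K y + (B₂ - H B₁) u`, in which
`A₂₂ - H A₁₂` generates `S`, is an exponential estimator: for every locally integrable input, every
initial state of the system and every `φ₀` it has a mild solution, and `φ + H y` satisfies
`‖φ t + H (y t) - x₂ t‖ ≤ M exp (-α t) ‖φ₀ + H (y 0) - x₂ 0‖`. Here `(y, x₂) = w` is the mild
solution of the system, whose operator generates `T`. -/
def IsReducedExpEstimator (T : ℝ → (Y × X₂) →L[ℝ] (Y × X₂)) (H K : Y →L[ℝ] X₂)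
    (S : ℝ → X₂ →L[ℝ] X₂) (M α : ℝ) : Prop :=
  ∀ (u : ℝ → EuclideanSpace ℝ (Fin p)), LocallyIntegrableOn u (Ici 0) →
  ∀ (w₀ : Y × X₂) (w : ℝ → Y × X₂), IsMildSolution T w₀ (fun τ => P.inputOp (u τ)) w →
  ∀ φ₀ : X₂,
    (∃ φ : ℝ → X₂, IsMildSolution S φ₀ (P.reducedForcing H K u fun τ => (w τ).1) φ) ∧
    ∀ φ : ℝ → X₂, IsMildSolution S φ₀ (P.reducedForcing H K u fun τ => (w τ).1) φ →
      ∀ t : ℝ, 0 ≤ t →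
        ‖φ t + H (w t).1 - (w t).2‖ ≤ M * Real.exp (-α * t) * ‖φ₀ + H w₀.1 - w₀.2‖

/-- The system is exponentially observable through an estimator
`z' = A₂₂ z + [B₂ u + A₂₁ y] + H (ỹ - A₁₂ z)`. -/
def IsObservable : Prop :=
  ∃ (H : Y →L[ℝ] X₂) (M α : ℝ), 0 < M ∧ 0 < α ∧ P.IsExpEstimator H M α

/-- The system is exponentially observable through a reduced estimator
`φ' = (A₂₂ - H A₁₂) φ + [A₂₂ H - H A₁₂ H - H A₁₁ + A₂₁] y + (B₂ - H B₁) u`,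
`x₂ ≈ φ + H y`. -/
def IsReducedObservable (T : ℝ → (Y × X₂) →L[ℝ] (Y × X₂)) : Prop :=
  ∃ (H K : Y →L[ℝ] X₂) (S : ℝ → X₂ →L[ℝ] X₂) (M α : ℝ),
    P.HasBoundedCoefficient H K ∧ IsC0Semigroup S ∧ IsGenerator (P.errorOp H) S ∧
    0 < M ∧ 0 < α ∧ P.IsReducedExpEstimator T H K S M α

end PartitionedSystem

end RegionalObs

end

/-! For (E) the known terms cancel in `e = z - x₂`, leaving `e' = (A₂₂ - H A₁₂) e` for `t > 0`. The
function `σ ↦ S (t - σ) (e σ)` then has zero right derivative on `(0, t)` and is continuous on `[0,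
t]`, so its end values agree: `e t = S t (e 0)`. This is `IsGenerator.integral_comp_sub` with zero
forcing. Conversely, `x₂` plus an orbit of `S` starting in the generator's domain solves (E).

For (R) the solutions are only mild, so nothing can be differentiated directly. Put `L (x₁, x₂) = x₂
- H x₁`, `E = A₂₂ - H A₁₂` and `Q (x₁, x₂) = K x₁`. The formula for `K` says exactly that `L A = E L
+ Q` on the domain of the block operator `A`. Differentiating `S (t - r) L T r x` for `x` in that
domain, integrating, and using density gives `L T t = S t L + ∫ S (t - r) Q T r dr`
(`IsGenerator.intertwine`). Fubini on a triangle carries this over to forced mild solutions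
(`IsMildSolution.intertwine`), so `x₂ - H y` is a mild solution of (R). Subtracting it from `φ`
leaves `S t` applied to the initial error. -/

noncomputable section

namespace RegionalObs

/-! ### Semigroups, generators and one-sided calculus -/

section SemigroupTheory

variable {X : Type*} [NormedAddCommGroup X] [NormedSpace ℝ X]

/-- Generators are defined by right difference quotients at `0`; this puts them in the form that the
one-sided fundamental theorem of calculus accepts. -/
theorem hasDerivWithinAt_Ioi_iff_tendsto {f : ℝ → X} {f' : X} {r : ℝ} :
    HasDerivWithinAt f f' (Ioi r) r ↔
      Tendsto (fun h : ℝ => h⁻¹ • (f (r + h) - f r)) (𝓝[>] 0) (𝓝 f') := by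
  rw [hasDerivWithinAt_iff_tendsto_slope' (by simp)]
  have hm : map (fun h : ℝ => r + h) (𝓝[>] 0) = 𝓝[>] r := by simp
  rw [← hm, tendsto_map'_iff]
  refine tendsto_congr fun h => ?_
  simp [slope]

/-- Uniform boundedness principle: each orbit is continuous, hence bounded on the compact interval.
-/
theorem IsC0Semigroup.exists_bound [CompleteSpace X] {S : ℝ → X →L[ℝ] X} (hS : IsC0Semigroup S)
    (b : ℝ) : ∃ C, 0 ≤ C ∧ ∀ t, 0 ≤ t → t ≤ b → ‖S t‖ ≤ C := by
  have h : ∀ x, ∃ C, ∀ i : Icc (0 : ℝ) b, ‖S i x‖ ≤ C := by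
    intro x
    obtain ⟨C, hC⟩ := (isCompact_Icc (a := (0 : ℝ)) (b := b)).exists_bound_of_continuousOn
      ((hS.continuousOn x).mono Icc_subset_Ici_self)
    exact ⟨C, fun i => hC i i.2⟩
  obtain ⟨C, hC⟩ := banach_steinhaus h
  exact ⟨max C 0, le_max_right _ _, fun t h0 hb => (hC ⟨t, h0, hb⟩).trans (le_max_left _ _)⟩

/-- A strongly continuous semigroup, extended by the identity to negative times, is jointly
continuous. -/
theorem IsC0Semigroup.continuous_uncurry [CompleteSpace X] {S : ℝ → X →L[ℝ] X}
    (hS : IsC0Semigroup S) : Continuous fun q : ℝ × X => S (max q.1 0) q.2 := by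
  have orbit : ∀ x, Continuous fun t : ℝ => S (max t 0) x := fun x =>
    (hS.continuousOn x).comp_continuous (by fun_prop) fun t => le_max_right t 0
  refine continuous_iff_continuousAt.2 fun ⟨t, x⟩ => ?_
  obtain ⟨C, hC0, hC⟩ := hS.exists_bound (max (t + 1) 0)
  rw [ContinuousAt, tendsto_iff_norm_sub_tendsto_zero]
  have hlim : Tendsto (fun q : ℝ × X => C * ‖q.2 - x‖ + ‖S (max q.1 0) x - S (max t 0) x‖)
      (𝓝 (t, x)) (𝓝 0) := by
    have hc : Continuous fun q : ℝ × X =>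
        C * ‖q.2 - x‖ + ‖S (max q.1 0) x - S (max t 0) x‖ := by
      have := (orbit x).comp (continuous_fst (X := ℝ) (Y := X))
      exact (continuous_const.mul (continuous_snd.sub continuous_const).norm).add
        (this.sub continuous_const).norm
    simpa using hc.tendsto (t, x)
  refine squeeze_zero' (Eventually.of_forall fun _ => norm_nonneg _) ?_ hlim
  have hev : ∀ᶠ q : ℝ × X in 𝓝 (t, x), q.1 < t + 1 :=
    continuous_fst.continuousAt.eventually_lt continuousAt_const (by simp)
  filter_upwards [hev] with q hq
  -- The first summand is small by the uniform bound near `t`, the second by continuity of the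
  -- single orbit of `x`.
  have h1 : S (max q.1 0) q.2 - S (max t 0) x
      = S (max q.1 0) (q.2 - x) + (S (max q.1 0) x - S (max t 0) x) := by
    rw [map_sub]; abel
  rw [h1]
  refine (norm_add_le _ _).trans (add_le_add_left ?_ _)
  exact ((S _).le_opNorm _).trans (mul_le_mul_of_nonneg_right
    (hC _ (le_max_right _ _) (max_le_max hq.le le_rfl)) (norm_nonneg _))

theorem IsC0Semigroup.continuous_comp [CompleteSpace X] {S : ℝ → X →L[ℝ] X}
    (hS : IsC0Semigroup S) {Z : Type*} [TopologicalSpace Z] {f : Z → ℝ} {g : Z → X}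
    (hf : Continuous f) (hg : Continuous g) : Continuous fun z => S (max (f z) 0) (g z) :=
  hS.continuous_uncurry.comp (hf.prodMk hg)

theorem IsC0Semigroup.continuousOn_comp [CompleteSpace X] {S : ℝ → X →L[ℝ] X}
    (hS : IsC0Semigroup S) {Z : Type*} [TopologicalSpace Z] {s : Set Z} {f : Z → ℝ} {g : Z → X}
    (hf : ContinuousOn f s) (hg : ContinuousOn g s) (h0 : ∀ z ∈ s, 0 ≤ f z) :
    ContinuousOn (fun z => S (f z) (g z)) s :=
  (hS.continuous_uncurry.comp_continuousOn (hf.prodMk hg)).congr fun z hz => by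
    simp [max_eq_left (h0 z hz)]

theorem IsC0Semigroup.map_add_apply {S : ℝ → X →L[ℝ] X} (hS : IsC0Semigroup S) {s t : ℝ}
    (hs : 0 ≤ s) (ht : 0 ≤ t) (x : X) : S (s + t) x = S s (S t x) := by
  rw [hS.map_add s t hs ht]; rfl

theorem IsC0Semigroup.apply_zero {S : ℝ → X →L[ℝ] X} (hS : IsC0Semigroup S) (x : X) :
    S 0 x = x := by
  rw [hS.map_zero]; rfl

/-- The domain of the generator is invariant, and the generator commutes with the semigroup. -/
theorem IsGenerator.apply_mem_graph {A : X →ₗ.[ℝ] X} {S : ℝ → X →L[ℝ] X}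
    (hA : IsGenerator A S) (hS : IsC0Semigroup S) {x y : X} (h : (x, y) ∈ A.graph) {t : ℝ}
    (ht : 0 ≤ t) : (S t x, S t y) ∈ A.graph := by
  rw [hA] at h ⊢
  refine (((S t).continuous.tendsto y).comp h).congr' ?_
  filter_upwards [self_mem_nhdsWithin] with r hr
  have hr : 0 ≤ r := le_of_lt hr
  simp only [Function.comp_apply, map_smul, map_sub]
  rw [← hS.map_add_apply ht hr, ← hS.map_add_apply hr ht, add_comm]

/-- Right derivatives of orbits starting in the domain of the generator. -/
theorem IsGenerator.tendsto_slope_orbit {A : X →ₗ.[ℝ] X} {S : ℝ → X →L[ℝ] X}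
    (hA : IsGenerator A S) (hS : IsC0Semigroup S) {x y : X} (h : (x, y) ∈ A.graph) {t : ℝ}
    (ht : 0 ≤ t) :
    Tendsto (fun r : ℝ => r⁻¹ • (S (t + r) x - S t x)) (𝓝[>] 0) (𝓝 (S t y)) := by
  refine ((hA _ _).1 (hA.apply_mem_graph hS h ht)).congr' ?_
  filter_upwards [self_mem_nhdsWithin] with r hr
  rw [← hS.map_add_apply (le_of_lt hr) ht, add_comm]

/-- The right derivative of `σ ↦ S (t - σ) (g σ)`. -/
theorem IsGenerator.hasDerivWithinAt_comp_sub [CompleteSpace X] {A : X →ₗ.[ℝ] X}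
    {S : ℝ → X →L[ℝ] X} (hA : IsGenerator A S) (hS : IsC0Semigroup S) {g : ℝ → X} {g' y : X}
    {r t : ℝ} (hrt : r < t)
    (hg : Tendsto (fun h : ℝ => h⁻¹ • (g (r + h) - g r)) (𝓝[>] 0) (𝓝 g'))
    (hy : (g r, y) ∈ A.graph) :
    HasDerivWithinAt (fun σ => S (t - σ) (g σ)) (S (t - r) (g' - y)) (Ioi r) r := by
  rw [hasDerivWithinAt_Ioi_iff_tendsto]
  -- The semigroup law pulls out the factor `S (t - r - h)`: the difference quotient is this
  -- operator applied to the quotient of `g` minus the quotient of the orbit of `g r`. Joint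
  -- continuity gives the limit.
  have h1 := hg.sub ((hA _ _).1 hy)
  have h2 : Tendsto (fun h : ℝ => t - (r + h)) (𝓝[>] 0) (𝓝 (t - r)) := by
    have : Continuous fun h : ℝ => t - (r + h) := by fun_prop
    simpa using (this.tendsto 0).mono_left nhdsWithin_le_nhds
  have h3 := (hS.continuous_uncurry.tendsto (t - r, g' - y)).comp (h2.prodMk_nhds h1)
  simp only [max_eq_left (sub_pos.2 hrt).le] at h3
  refine h3.congr' ?_
  filter_upwards [Ioo_mem_nhdsGT (sub_pos.2 hrt)] with h hh
  have e1 : 0 ≤ t - (r + h) := by linarith [hh.2]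
  have e2 : t - r = (t - (r + h)) + h := by ring
  simp only [Function.comp_apply, max_eq_left e1]
  rw [e2, hS.map_add_apply e1 hh.1.le, ← smul_sub, map_smul, ← map_sub]
  congr 2
  abel

/-- The variation of constants formula for functions with values in the domain of the
generator. -/
theorem IsGenerator.integral_comp_sub [CompleteSpace X] {A : X →ₗ.[ℝ] X}
    {S : ℝ → X →L[ℝ] X} (hA : IsGenerator A S) (hS : IsC0Semigroup S) {g f : ℝ → X} {t : ℝ}
    (ht : 0 ≤ t) (hgc : ContinuousOn g (Icc 0 t))
    (hg : ∀ r ∈ Ioo 0 t, ∃ g' y, Tendsto (fun h : ℝ => h⁻¹ • (g (r + h) - g r)) (𝓝[>] 0) (𝓝 g') ∧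
      (g r, y) ∈ A.graph ∧ g' - y = f r)
    (hf : ContinuousOn f (Icc 0 t)) :
    g t = S t (g 0) + ∫ r in (0 : ℝ)..t, S (t - r) (f r) := by
  have hsub : ContinuousOn (fun r : ℝ => t - r) (Icc 0 t) := by fun_prop
  have h0 : ∀ r ∈ Icc 0 t, 0 ≤ t - r := fun r hr => sub_nonneg.2 hr.2
  -- Right derivatives in the open interval suffice, so no equation is needed at `0` or `t`.
  have key := intervalIntegral.integral_eq_sub_of_hasDeriv_right
    (f := fun r => S (t - r) (g r)) (f' := fun r => S (t - r) (f r)) (a := 0) (b := t)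
    (by rw [uIcc_of_le ht]; exact hS.continuousOn_comp hsub hgc h0)
    (by
      rw [min_eq_left ht, max_eq_right ht]
      intro r hr
      obtain ⟨g', y, h1, h2, h3⟩ := hg r hr
      exact h3 ▸ hA.hasDerivWithinAt_comp_sub hS hr.2 h1 h2)
    (by
      refine ContinuousOn.intervalIntegrable ?_
      rw [uIcc_of_le ht]; exact hS.continuousOn_comp hsub hf h0)
  rw [key]
  simp [hS.apply_zero]

/-- Two-sided derivatives of orbits starting in the domain of the generator. -/
theorem IsGenerator.hasDerivAt_orbit [CompleteSpace X] {A : X →ₗ.[ℝ] X}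
    {S : ℝ → X →L[ℝ] X} (hA : IsGenerator A S) (hS : IsC0Semigroup S) {x y : X}
    (h : (x, y) ∈ A.graph) {t : ℝ} (ht : 0 < t) : HasDerivAt (fun s => S s x) (S t y) t := by
  have hc : Continuous fun s : ℝ => S (max s 0) y :=
    hS.continuous_comp continuous_id continuous_const
  -- Integrating the right derivative exhibits the orbit as a primitive of a continuous function,
  -- which is differentiable from both sides.
  have key : ∀ s, 0 ≤ s → x + ∫ r in (0 : ℝ)..s, S (max r 0) y = S s x := by
    intro s hs
    have := intervalIntegral.integral_eq_sub_of_hasDeriv_right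
      (f := fun r => S r x) (f' := fun r => S (max r 0) y) (a := 0) (b := s)
      (by rw [uIcc_of_le hs]; exact (hS.continuousOn x).mono Icc_subset_Ici_self)
      (by
        rw [min_eq_left hs, max_eq_right hs]
        intro r hr
        rw [hasDerivWithinAt_Ioi_iff_tendsto, max_eq_left hr.1.le]
        exact hA.tendsto_slope_orbit hS h hr.1.le)
      (hc.intervalIntegrable _ _)
    rw [this, hS.apply_zero]
    abel
  have hd : HasDerivAt (fun s => x + ∫ r in (0 : ℝ)..s, S (max r 0) y) (S (max t 0) y) t :=
    (intervalIntegral.integral_hasDerivAt_right (hc.intervalIntegrable _ _)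
      (hc.stronglyMeasurableAtFilter _ _) hc.continuousAt).const_add x
  rw [max_eq_left ht.le] at hd
  refine hd.congr_of_eventuallyEq ?_
  filter_upwards [lt_mem_nhds ht] with s hs
  exact (key s hs.le).symm

/-- The domain of the generator of a strongly continuous semigroup is dense. -/
theorem IsGenerator.dense_domain [CompleteSpace X] {A : X →ₗ.[ℝ] X}
    {S : ℝ → X →L[ℝ] X} (hA : IsGenerator A S) (hS : IsC0Semigroup S) :
    Dense (A.domain : Set X) := by
  intro x
  have hc : Continuous fun s : ℝ => S (max s 0) x :=
    hS.continuous_comp continuous_id continuous_const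
  set F : ℝ → X := fun s => ∫ r in (0 : ℝ)..s, S (max r 0) x with hF
  have hd : ∀ s, HasDerivAt F (S (max s 0) x) s := fun s =>
    intervalIntegral.integral_hasDerivAt_right (hc.intervalIntegrable _ _)
      (hc.stronglyMeasurableAtFilter _ _) hc.continuousAt
  have hF0 : F 0 = 0 := by simp [hF]
  -- Time averages are smooth: `S h (F b) - F b = (F (b + h) - F b) - (F h - F 0)`, and both
  -- quotients converge.
  have hmem : ∀ b, 0 < b → F b ∈ A.domain := by
    intro b hb
    have h1 := (hd b).tendsto_slope_zero_right
    have h2 := (hd 0).tendsto_slope_zero_right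
    have h3 := h1.sub h2
    refine LinearPMap.mem_domain_of_mem_graph ((hA (F b) _).2 (h3.congr' ?_))
    filter_upwards [self_mem_nhdsWithin] with h hh
    have hh : 0 < h := hh
    rw [← smul_sub]
    congr 1
    have e1 : S h (F b) = ∫ r in (0 : ℝ)..b, S (max (r + h) 0) x := by
      rw [hF, ← ContinuousLinearMap.intervalIntegral_comp_comm _ (hc.intervalIntegrable _ _)]
      refine intervalIntegral.integral_congr fun r hr => ?_
      rw [uIcc_of_le hb.le] at hr
      rw [← hS.map_add_apply hh.le (le_max_right _ _), max_eq_left hr.1,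
        max_eq_left (by linarith [hr.1]), add_comm]
    have e2 : (∫ r in (0 : ℝ)..b, S (max (r + h) 0) x) = F (b + h) - F h := by
      rw [intervalIntegral.integral_comp_add_right (fun r => S (max r 0) x), zero_add, hF,
        intervalIntegral.integral_interval_sub_left] <;> exact hc.intervalIntegrable _ _
    rw [e1, e2, hF0, zero_add]
    abel
  -- The averages `h⁻¹ • F h` lie in the domain and tend to `x`.
  have hlim := (hd 0).tendsto_slope_zero_right
  simp only [zero_add, hF0, sub_zero, max_self, hS.apply_zero] at hlim
  refine mem_closure_of_tendsto hlim ?_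
  filter_upwards [self_mem_nhdsWithin] with h hh
  exact A.domain.smul_mem _ (hmem h hh)

end SemigroupTheory

/-! ### Convolutions and intertwined mild solutions -/

section MildSolutions

variable {W X : Type*} [NormedAddCommGroup W] [NormedSpace ℝ W] [CompleteSpace W]
  [NormedAddCommGroup X] [NormedSpace ℝ X] [CompleteSpace X]

/-- Joint continuity gives measurability, and the bound on `[0, t]` gives the majorant `C * ‖f τ‖`.
-/
theorem IsC0Semigroup.integrableOn_convolution {S : ℝ → X →L[ℝ] X} (hS : IsC0Semigroup S)
    {f : ℝ → X} {t : ℝ} (hf : IntegrableOn f (Ioc 0 t)) :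
    IntegrableOn (fun τ => S (t - τ) (f τ)) (Ioc 0 t) := by
  obtain ⟨C, -, hC⟩ := hS.exists_bound t
  refine Integrable.mono' (hf.norm.const_mul C) ?_ ?_
  · have h1 : AEStronglyMeasurable (fun τ => S (max (t - τ) 0) (f τ)) (volume.restrict (Ioc 0 t)) :=
      hS.continuous_uncurry.comp_aestronglyMeasurable
        (((continuous_const.sub continuous_id).aestronglyMeasurable).prodMk hf.1)
    refine h1.congr (ae_restrict_of_forall_mem measurableSet_Ioc fun τ hτ => ?_)
    simp only [max_eq_left (sub_nonneg.2 hτ.2)]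
  · refine ae_restrict_of_forall_mem measurableSet_Ioc fun τ hτ => ?_
    exact ((S _).le_opNorm _).trans (mul_le_mul_of_nonneg_right
      (hC _ (sub_nonneg.2 hτ.2) (by linarith [hτ.1])) (norm_nonneg _))

theorem IsC0Semigroup.intervalIntegrable_convolution {S : ℝ → X →L[ℝ] X} (hS : IsC0Semigroup S)
    {f : ℝ → X} {t : ℝ} (ht : 0 ≤ t) (hf : IntegrableOn f (Ioc 0 t)) :
    IntervalIntegrable (fun τ => S (t - τ) (f τ)) volume 0 t :=
  (intervalIntegrable_iff_integrableOn_Ioc_of_le ht).2 (hS.integrableOn_convolution hf)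

/-- The kernel of the iterated convolution of `f` with `T` and `S`, on the triangle
`0 < τ < r ≤ t`. -/
def triangleKernel (S : ℝ → X →L[ℝ] X) (Q : W →L[ℝ] X) (T : ℝ → W →L[ℝ] W) (f : ℝ → W) (t : ℝ) :
    ℝ × ℝ → X :=
  {q : ℝ × ℝ | q.2 < q.1}.indicator fun q => S (t - q.1) (Q (T (q.1 - q.2) (f q.2)))

/-- This licenses Fubini. The majorant `C * (‖Q‖ * D) * ‖f τ‖` is constant in the first variable,
which ranges over a set of finite measure. -/
theorem integrable_triangleKernel {S : ℝ → X →L[ℝ] X} (hS : IsC0Semigroup S)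
    {T : ℝ → W →L[ℝ] W} (hT : IsC0Semigroup T) (Q : W →L[ℝ] X) {f : ℝ → W} {t : ℝ}
    (hf : IntegrableOn f (Ioc 0 t)) :
    Integrable (triangleKernel S Q T f t)
      ((volume.restrict (Ioc 0 t)).prod (volume.restrict (Ioc 0 t))) := by
  obtain ⟨C, hC0, hC⟩ := hS.exists_bound t
  obtain ⟨D, hD0, hD⟩ := hT.exists_bound t
  have hmeas : MeasurableSet {q : ℝ × ℝ | q.2 < q.1} :=
    measurableSet_lt measurable_snd measurable_fst
  have hbox : MeasurableSet (Ioc (0 : ℝ) t ×ˢ Ioc (0 : ℝ) t) :=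
    measurableSet_Ioc.prod measurableSet_Ioc
  have hint : Integrable (fun q : ℝ × ℝ => f q.2)
      ((volume.restrict (Ioc 0 t)).prod (volume.restrict (Ioc 0 t))) :=
    Integrable.comp_snd hf _
  refine Integrable.mono' (hint.norm.const_mul (C * (‖Q‖ * D))) ?_ ?_
  -- Clamping both times at `0` gives a globally continuous expression that agrees with the kernel
  -- on the part of the triangle in the box.
  · have hc : Continuous fun z : (ℝ × ℝ) × W =>
        S (max (t - z.1.1) 0) (Q (T (max (z.1.1 - z.1.2) 0) z.2)) :=
      hS.continuous_comp (by fun_prop)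
        (Q.continuous.comp (hT.continuous_comp (by fun_prop) continuous_snd))
    have h1 := (hc.comp_aestronglyMeasurable
      (continuous_id.aestronglyMeasurable.prodMk hint.1)).indicator hmeas
    refine h1.congr ?_
    rw [Measure.prod_restrict]
    refine ae_restrict_of_forall_mem hbox fun q hq => ?_
    by_cases h : q.2 < q.1
    · have h' : q ∈ {q : ℝ × ℝ | q.2 < q.1} := h
      simp only [triangleKernel, indicator_of_mem h', id,
        max_eq_left (sub_nonneg.2 h.le), max_eq_left (sub_nonneg.2 hq.1.2)]
    · have h' : q ∉ {q : ℝ × ℝ | q.2 < q.1} := h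
      simp only [triangleKernel, indicator_of_notMem h']
  · rw [Measure.prod_restrict]
    refine ae_restrict_of_forall_mem hbox fun q hq => ?_
    by_cases h : q.2 < q.1
    · have h' : q ∈ {q : ℝ × ℝ | q.2 < q.1} := h
      rw [triangleKernel, indicator_of_mem h', mul_assoc, mul_assoc]
      refine (ContinuousLinearMap.le_of_opNorm_le _
        (hC _ (sub_nonneg.2 hq.1.2) (by linarith [hq.1.1])) _).trans ?_
      refine mul_le_mul_of_nonneg_left ((Q.le_opNorm _).trans ?_) hC0
      refine mul_le_mul_of_nonneg_left (ContinuousLinearMap.le_of_opNorm_le _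
        (hD _ (sub_nonneg.2 h.le) (by linarith [hq.1.2, hq.2.1])) _) (norm_nonneg _)
    · have h' : q ∉ {q : ℝ × ℝ | q.2 < q.1} := h
      rw [triangleKernel, indicator_of_notMem h', norm_zero]
      positivity

theorem integral_triangleKernel_snd {S : ℝ → X →L[ℝ] X}
    {T : ℝ → W →L[ℝ] W} (hT : IsC0Semigroup T) (Q : W →L[ℝ] X) {f : ℝ → W} {t r : ℝ}
    (hf : IntegrableOn f (Ioc 0 t)) (hr : r ∈ Ioc 0 t) :
    ∫ τ in Ioc 0 t, triangleKernel S Q T f t (r, τ)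
      = S (t - r) (Q (∫ τ in (0 : ℝ)..r, T (r - τ) (f τ))) := by
  have h1 : (fun τ => triangleKernel S Q T f t (r, τ))
      = (Iio r).indicator fun τ => S (t - r) (Q (T (r - τ) (f τ))) := by
    ext τ
    simp [triangleKernel, indicator]
  have h2 : Ioc 0 t ∩ Iio r = Ioo 0 r := by
    ext τ
    simp only [mem_inter_iff, mem_Ioc, mem_Iio, mem_Ioo]
    exact ⟨fun h => ⟨h.1.1, h.2⟩, fun h => ⟨⟨h.1, h.2.le.trans hr.2⟩, h.2⟩⟩
  -- The strict inequality in the kernel drops only the null point `τ = r`.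
  rw [h1, setIntegral_indicator measurableSet_Iio, h2, ← integral_Ioc_eq_integral_Ioo,
    intervalIntegral.integral_of_le hr.1.le]
  exact ((S (t - r)).comp Q).integral_comp_comm
    (hT.integrableOn_convolution (hf.mono_set (Ioc_subset_Ioc_right hr.2)))

omit [CompleteSpace W] [CompleteSpace X] in
-- The shift `σ = r - τ` turns this slice into the correction term of `IsGenerator.intertwine` at
-- time `t - τ`, applied to `f τ`.
theorem integral_triangleKernel_fst (S : ℝ → X →L[ℝ] X)
    (T : ℝ → W →L[ℝ] W) (Q : W →L[ℝ] X) (f : ℝ → W) {t τ : ℝ} (hτ : τ ∈ Ioc 0 t) :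
    ∫ r in Ioc 0 t, triangleKernel S Q T f t (r, τ)
      = ∫ σ in (0 : ℝ)..(t - τ), S (t - τ - σ) (Q (T σ (f τ))) := by
  have h1 : (fun r => triangleKernel S Q T f t (r, τ))
      = (Ioi τ).indicator fun r => S (t - r) (Q (T (r - τ) (f τ))) := by
    ext r
    simp [triangleKernel, indicator]
  have h2 : Ioc 0 t ∩ Ioi τ = Ioc τ t := by
    ext r
    simp only [mem_inter_iff, mem_Ioc, mem_Ioi]
    exact ⟨fun h => ⟨h.2, h.1.2⟩, fun h => ⟨⟨hτ.1.trans h.1, h.2⟩, h.1⟩⟩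
  rw [h1, setIntegral_indicator measurableSet_Ioi, h2, ← intervalIntegral.integral_of_le hτ.2]
  have h3 := intervalIntegral.integral_comp_sub_right
    (fun σ => S (t - τ - σ) (Q (T σ (f τ)))) τ (a := τ) (b := t)
  rw [sub_self] at h3
  rw [← h3]
  simp only [sub_sub_sub_cancel_right]

/-- If `L` intertwines the generators of `T` and `S` up to the bounded operator `Q`, then it
intertwines the semigroups up to a convolution. -/
theorem IsGenerator.intertwine {A : W →ₗ.[ℝ] W} {T : ℝ → W →L[ℝ] W} (hT : IsC0Semigroup T)
    (hA : IsGenerator A T) {E : X →ₗ.[ℝ] X} {S : ℝ → X →L[ℝ] X} (hS : IsC0Semigroup S)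
    (hE : IsGenerator E S) (L Q : W →L[ℝ] X)
    (hL : ∀ x y, (x, y) ∈ A.graph → (L x, L y - Q x) ∈ E.graph) {t : ℝ} (ht : 0 ≤ t) (x : W) :
    L (T t x) = S t (L x) + ∫ r in (0 : ℝ)..t, S (t - r) (Q (T r x)) := by
  have hmax : ∀ x, (∫ r in (0 : ℝ)..t, S (t - r) (Q (T r x)))
      = ∫ r in (0 : ℝ)..t, S (max (t - r) 0) (Q (T (max r 0) x)) := fun x => by
    refine intervalIntegral.integral_congr fun r hr => ?_
    rw [uIcc_of_le ht] at hr
    simp only [max_eq_left hr.1, max_eq_left (sub_nonneg.2 hr.2)]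
  have hc : Continuous fun x => S t (L x) + ∫ r in (0 : ℝ)..t, S (t - r) (Q (T r x)) := by
    simp only [hmax]
    refine ((S t).continuous.comp L.continuous).add
      (intervalIntegral.continuous_parametric_intervalIntegral_of_continuous' ?_ _ _)
    exact hS.continuous_comp (by fun_prop)
      (Q.continuous.comp (hT.continuous_comp continuous_snd continuous_fst))
  -- Both sides are continuous in `x`, so it is enough to treat the dense domain of `A`.
  refine congrFun (Continuous.ext_on (hA.dense_domain hT)
    (L.continuous.comp (T t).continuous) hc fun x hx => ?_) x
  have hx' : (x, A ⟨x, hx⟩) ∈ A.graph := A.mem_graph ⟨x, hx⟩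
  have horb : ContinuousOn (fun r => T r x) (Icc 0 t) :=
    (hT.continuousOn x).mono Icc_subset_Ici_self
  -- The right derivative of `L (T r x)` is `L (T r (A x))`; by `hL` it exceeds the value of `E`
  -- there by `Q (T r x)`, which is therefore the forcing.
  have key := hE.integral_comp_sub hS (g := fun r => L (T r x)) (f := fun r => Q (T r x)) ht
    (L.continuous.comp_continuousOn horb)
    (fun r hr => ⟨L (T r (A ⟨x, hx⟩)), _, ?_, hL _ _ (hA.apply_mem_graph hT hx' hr.1.le),
      sub_sub_cancel _ _⟩) (Q.continuous.comp_continuousOn horb)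
  · simpa only [hT.apply_zero, Function.comp_apply] using key
  · simpa only [Function.comp_def, map_smul, map_sub] using
      (L.continuous.tendsto _).comp (hA.tendsto_slope_orbit hT hx' hr.1.le)

/-- If `L` intertwines the generators of `T` and `S` up to the bounded operator `Q`, then it maps
mild solutions of `w' = A w + f` to mild solutions of `x' = E x + Q w + L f`. -/
theorem IsMildSolution.intertwine {A : W →ₗ.[ℝ] W} {T : ℝ → W →L[ℝ] W} (hT : IsC0Semigroup T)
    (hA : IsGenerator A T) {E : X →ₗ.[ℝ] X} {S : ℝ → X →L[ℝ] X} (hS : IsC0Semigroup S)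
    (hE : IsGenerator E S) (L Q : W →L[ℝ] X)
    (hL : ∀ x y, (x, y) ∈ A.graph → (L x, L y - Q x) ∈ E.graph) {w₀ : W} {f w : ℝ → W}
    (hf : ∀ t, IntegrableOn f (Ioc 0 t)) (hw : IsMildSolution T w₀ f w) :
    IsMildSolution S (L w₀) (fun τ => Q (w τ) + L (f τ)) fun t => L (w t) := by
  intro t ht
  have hk := integrable_triangleKernel hS hT Q (hf t)
  set I : ℝ → W := fun r => ∫ τ in (0 : ℝ)..r, T (r - τ) (f τ) with hI
  set J : ℝ → X := fun τ => ∫ σ in (0 : ℝ)..(t - τ), S (t - τ - σ) (Q (T σ (f τ))) with hJ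
  -- Integrability comes from Fubini's theorem, so continuity of `I` need not be established.
  have hIint : IntervalIntegrable (fun r => S (t - r) (Q (I r))) volume 0 t := by
    rw [intervalIntegrable_iff_integrableOn_Ioc_of_le ht]
    refine hk.integral_prod_left.congr (ae_restrict_of_forall_mem measurableSet_Ioc fun r hr => ?_)
    exact integral_triangleKernel_snd hT Q (hf t) hr
  have hJint : IntervalIntegrable J volume 0 t := by
    rw [intervalIntegrable_iff_integrableOn_Ioc_of_le ht]
    refine hk.integral_prod_right.congr
      (ae_restrict_of_forall_mem measurableSet_Ioc fun τ hτ => ?_)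
    exact integral_triangleKernel_fst S T Q f hτ
  have hswap : (∫ τ in (0 : ℝ)..t, J τ) = ∫ r in (0 : ℝ)..t, S (t - r) (Q (I r)) := by
    rw [intervalIntegral.integral_of_le ht, intervalIntegral.integral_of_le ht,
      ← setIntegral_congr_fun measurableSet_Ioc
        (fun τ hτ => integral_triangleKernel_fst S T Q f hτ),
      ← setIntegral_congr_fun measurableSet_Ioc
        (fun r hr => integral_triangleKernel_snd hT Q (hf t) hr)]
    exact (integral_integral_swap (f := fun r τ => triangleKernel S Q T f t (r, τ)) hk).symm
  have hLf : IntervalIntegrable (fun τ => S (t - τ) (L (f τ))) volume 0 t :=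
    hS.intervalIntegrable_convolution ht (L.integrable_comp (hf t))
  have horb : IntervalIntegrable (fun r => S (t - r) (Q (T r w₀))) volume 0 t := by
    refine ContinuousOn.intervalIntegrable ?_
    rw [uIcc_of_le ht]
    exact hS.continuousOn_comp (by fun_prop) (Q.continuous.comp_continuousOn
      ((hT.continuousOn w₀).mono Icc_subset_Ici_self)) fun r hr => sub_nonneg.2 hr.2
  have hcongr : EqOn (fun τ => S (t - τ) (Q (w τ) + L (f τ)))
      (fun τ => (S (t - τ) (Q (T τ w₀)) + S (t - τ) (Q (I τ))) + S (t - τ) (L (f τ)))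
      (uIcc 0 t) := by
    intro τ hτ
    rw [uIcc_of_le ht] at hτ
    simp only [(hw τ hτ.1).2, map_add, hI]
  refine ⟨((horb.add hIint).add hLf).congr fun τ hτ => (hcongr (uIoc_subset_uIcc hτ)).symm, ?_⟩
  -- The semigroup identity at time `t - τ`, applied to the vector `f τ`.
  have hsplit : EqOn (fun τ => L (T (t - τ) (f τ))) (fun τ => S (t - τ) (L (f τ)) + J τ)
      (uIcc 0 t) := by
    intro τ hτ
    rw [uIcc_of_le ht] at hτ
    exact hA.intertwine hT hS hE L Q hL (sub_nonneg.2 hτ.2) (f τ)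
  beta_reduce
  rw [(hw t ht).2, map_add, ← L.intervalIntegral_comp_comm (hw t ht).1,
    intervalIntegral.integral_congr hsplit, intervalIntegral.integral_congr hcongr,
    intervalIntegral.integral_add hLf hJint, intervalIntegral.integral_add (horb.add hIint) hLf,
    intervalIntegral.integral_add horb hIint, hswap, hA.intertwine hT hS hE L Q hL ht]
  abel

end MildSolutions

/-! ### Error dynamics of the two estimators -/

namespace PartitionedSystem

variable {p : ℕ} {Y X₂ : Type*} [NormedAddCommGroup Y] [InnerProductSpace ℝ Y]
  [NormedAddCommGroup X₂] [InnerProductSpace ℝ X₂] (P : PartitionedSystem p Y X₂)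

theorem errorOp_apply {H : Y →L[ℝ] X₂} {x : X₂} (h : x ∈ (P.errorOp H).domain) :
    P.errorOp H ⟨x, h⟩ = P.A₂₂ ⟨x, h.1⟩ - H (P.A₁₂ ⟨x, h.2⟩) :=
  rfl

variable {P}

/-- `(x₁, x₂) ↦ x₂ - H x₁` intertwines the block operator and the error operator, up to the
bounded coefficient of `H`. -/
theorem HasBoundedCoefficient.intertwine {H K : Y →L[ℝ] X₂} (hK : P.HasBoundedCoefficient H K)
    (w v : Y × X₂) (hwv : (w, v) ∈ P.blockOp.graph) :
    (w.2 - H w.1, v.2 - H v.1 - K w.1) ∈ (P.errorOp H).graph := by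
  obtain ⟨⟨w', hw⟩, h1, h2⟩ := (LinearPMap.mem_graph_iff _).1 hwv
  simp only at h1 h2
  subst h1
  have h11 : w'.1 ∈ P.A₁₁.domain := hw.1.1
  have h21 : w'.1 ∈ P.A₂₁.domain := hw.1.2
  have h12 : w'.2 ∈ P.A₁₂.domain := hw.2.1
  have h22 : w'.2 ∈ P.A₂₂.domain := hw.2.2
  -- That `H w'.1` lies in both domains is what allows `A₂₂` and `A₁₂` to be split over `w'.2 - H
  -- w'.1`.
  obtain ⟨k22, k12, hKy⟩ := hK w'.1 h11 h21
  have hdom : w'.2 - H w'.1 ∈ (P.errorOp H).domain :=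
    ⟨P.A₂₂.domain.sub_mem h22 k22, P.A₁₂.domain.sub_mem h12 k12⟩
  refine (LinearPMap.mem_graph_iff _).2 ⟨⟨_, hdom⟩, rfl, ?_⟩
  have e1 := P.A₂₂.map_sub ⟨_, h22⟩ ⟨_, k22⟩
  have e2 := P.A₁₂.map_sub ⟨_, h12⟩ ⟨_, k12⟩
  have e3 : P.errorOp H ⟨_, hdom⟩ = P.A₂₂ ⟨_, h22⟩ - P.A₂₂ ⟨_, k22⟩
      - H (P.A₁₂ ⟨_, h12⟩ - P.A₁₂ ⟨_, k12⟩) := by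
    rw [← e1, ← e2]; rfl
  have e4 : v = (P.A₁₁ ⟨w'.1, h11⟩ + P.A₁₂ ⟨w'.2, h12⟩,
      P.A₂₁ ⟨w'.1, h21⟩ + P.A₂₂ ⟨w'.2, h22⟩) := h2.symm
  rw [e3, e4, hKy, map_sub, map_add]
  dsimp only
  abel

/-- The equation for the estimation error. -/
theorem IsEstimate.hasDerivAt_error {H : Y →L[ℝ] X₂} {u : ℝ → EuclideanSpace ℝ (Fin p)}
    {x₁ : ℝ → Y} {x₂ z : ℝ → X₂} (hx : P.IsTrajectory u x₁ x₂) (hz : P.IsEstimate H u x₁ x₂ z)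
    {t : ℝ} (ht : 0 < t) :
    ∃ h : z t - x₂ t ∈ (P.errorOp H).domain,
      HasDerivAt (fun s => z s - x₂ s) (P.errorOp H ⟨z t - x₂ t, h⟩) t := by
  obtain ⟨h11, h12, h21, h22, -, hd⟩ := hx.equation t ht
  obtain ⟨k22, k12, _, _, hdz⟩ := hz.equation t ht
  have hdom : z t - x₂ t ∈ (P.errorOp H).domain :=
    ⟨P.A₂₂.domain.sub_mem k22 h22, P.A₁₂.domain.sub_mem k12 h12⟩
  refine ⟨hdom, ?_⟩
  have e1 := P.A₂₂.map_sub ⟨_, k22⟩ ⟨_, h22⟩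
  have e2 := P.A₁₂.map_sub ⟨_, k12⟩ ⟨_, h12⟩
  have e3 : P.errorOp H ⟨_, hdom⟩ = P.A₂₂ ⟨_, k22⟩ - P.A₂₂ ⟨_, h22⟩
      - H (P.A₁₂ ⟨_, k12⟩ - P.A₁₂ ⟨_, h12⟩) := by
    rw [← e1, ← e2]; rfl
  rw [e3]
  refine (hdz.sub hd).congr_deriv ?_
  simp only [map_sub]
  abel

/-- Add to `x₂` the orbit of the initial error. Since that error is in the generator's domain, the
orbit stays there and is differentiable. -/
theorem IsStabilizing.exists_isEstimate [CompleteSpace X₂] {H : Y →L[ℝ] X₂}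
    {S : ℝ → X₂ →L[ℝ] X₂} {M α : ℝ} (hS : P.IsStabilizing H S M α)
    {u : ℝ → EuclideanSpace ℝ (Fin p)} {x₁ : ℝ → Y} {x₂ : ℝ → X₂}
    (hx : P.IsTrajectory u x₁ x₂) {z₀ : X₂} (hz₀ : z₀ - x₂ 0 ∈ (P.errorOp H).domain) :
    ∃ z : ℝ → X₂, z 0 = z₀ ∧ P.IsEstimate H u x₁ x₂ z := by
  have hg : (z₀ - x₂ 0, P.errorOp H ⟨_, hz₀⟩) ∈ (P.errorOp H).graph :=
    (P.errorOp H).mem_graph ⟨_, hz₀⟩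
  refine ⟨fun t => S t (z₀ - x₂ 0) + x₂ t, by simp [hS.semigroup.apply_zero], ?_, ?_⟩
  · exact (hS.semigroup.continuousOn _).add hx.continuousOn₂
  intro t ht
  obtain ⟨h11, h12, h21, h22, -, hd⟩ := hx.equation t ht
  obtain ⟨⟨v, hdom⟩, h2, h3⟩ :=
    (LinearPMap.mem_graph_iff _).1 (hS.generator.apply_mem_graph hS.semigroup hg ht.le)
  simp only at h2 h3
  subst h2
  have k22 : S t (z₀ - x₂ 0) ∈ P.A₂₂.domain := hdom.1
  have k12 : S t (z₀ - x₂ 0) ∈ P.A₁₂.domain := hdom.2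
  refine ⟨P.A₂₂.domain.add_mem k22 h22, P.A₁₂.domain.add_mem k12 h12, h21, h12, ?_⟩
  refine ((hS.generator.hasDerivAt_orbit hS.semigroup hg ht).add hd).congr_deriv ?_
  have e1 : P.A₂₂ ⟨_, P.A₂₂.domain.add_mem k22 h22⟩ = _ := P.A₂₂.map_add ⟨_, k22⟩ ⟨_, h22⟩
  have e2 : P.A₁₂ ⟨_, P.A₁₂.domain.add_mem k12 h12⟩ = _ := P.A₁₂.map_add ⟨_, k12⟩ ⟨_, h12⟩
  rw [← h3, errorOp_apply, e1, e2]
  simp only [map_add, map_sub]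
  abel

theorem IsStabilizing.error_eq [CompleteSpace X₂] {H : Y →L[ℝ] X₂}
    {S : ℝ → X₂ →L[ℝ] X₂} {M α : ℝ} (hS : P.IsStabilizing H S M α)
    {u : ℝ → EuclideanSpace ℝ (Fin p)} {x₁ : ℝ → Y} {x₂ z : ℝ → X₂}
    (hx : P.IsTrajectory u x₁ x₂) (hz : P.IsEstimate H u x₁ x₂ z) {t : ℝ} (ht : 0 ≤ t) :
    z t - x₂ t = S t (z 0 - x₂ 0) := by
  have key := hS.generator.integral_comp_sub hS.semigroup (g := fun t => z t - x₂ t)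
    (f := fun _ => 0) ht
    ((hz.continuousOn.sub hx.continuousOn₂).mono Icc_subset_Ici_self) (fun r hr => ?_)
    continuousOn_const
  · simpa using key
  · obtain ⟨h, hd⟩ := hz.hasDerivAt_error hx hr.1
    exact ⟨_, _, hd.tendsto_slope_zero_right, (P.errorOp H).mem_graph ⟨_, h⟩, sub_self _⟩

theorem IsStabilizing.norm_apply_le {H : Y →L[ℝ] X₂}
    {S : ℝ → X₂ →L[ℝ] X₂} {M α : ℝ} (hS : P.IsStabilizing H S M α) {t : ℝ} (ht : 0 ≤ t)
    (x : X₂) : ‖S t x‖ ≤ M * Real.exp (-α * t) * ‖x‖ :=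
  ContinuousLinearMap.le_of_opNorm_le _ (hS.bound t ht) x

theorem IsStabilizing.tendsto_norm_zero {H : Y →L[ℝ] X₂}
    {S : ℝ → X₂ →L[ℝ] X₂} {M α : ℝ} (hS : P.IsStabilizing H S M α) {e : ℝ → X₂} {x : X₂}
    (he : ∀ t, 0 ≤ t → e t = S t x) : Tendsto (fun t => ‖e t‖) atTop (𝓝 0) := by
  have h1 : Tendsto (fun t => M * Real.exp (-α * t) * ‖x‖) atTop (𝓝 0) := by
    have h2 : Tendsto (fun t : ℝ => -α * t) atTop atBot :=
      tendsto_id.const_mul_atTop_of_neg (neg_lt_zero.2 hS.α_pos)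
    simpa using ((Real.tendsto_exp_atBot.comp h2).const_mul M).mul_const ‖x‖
  refine squeeze_zero' (Eventually.of_forall fun _ => norm_nonneg _) ?_ h1
  filter_upwards [eventually_ge_atTop 0] with t ht
  rw [he t ht]
  exact hS.norm_apply_le ht x

theorem IsStabilizing.isExpEstimator [CompleteSpace X₂] {H : Y →L[ℝ] X₂}
    {S : ℝ → X₂ →L[ℝ] X₂} {M α : ℝ} (hS : P.IsStabilizing H S M α) :
    P.IsExpEstimator H M α := by
  intro u x₁ x₂ hx
  refine ⟨fun z₀ hz₀ => hS.exists_isEstimate hx hz₀, fun z hz t ht => ?_⟩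
  rw [hS.error_eq hx hz ht]
  exact hS.norm_apply_le ht _

variable [CompleteSpace Y] [CompleteSpace X₂] {T : ℝ → (Y × X₂) →L[ℝ] (Y × X₂)}
  {H K : Y →L[ℝ] X₂} {S : ℝ → X₂ →L[ℝ] X₂} {M α : ℝ} {u : ℝ → EuclideanSpace ℝ (Fin p)}
  {w₀ : Y × X₂} {w : ℝ → Y × X₂}

/-- `x₂ - H y` is a mild solution of the reduced estimator. -/
theorem IsStabilizing.isMildSolution_reduced (hT : IsC0Semigroup T)
    (hTgen : IsGenerator P.blockOp T) (hS : P.IsStabilizing H S M α)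
    (hK : P.HasBoundedCoefficient H K) (hu : LocallyIntegrableOn u (Ici 0))
    (hw : IsMildSolution T w₀ (fun τ => P.inputOp (u τ)) w) :
    IsMildSolution S (w₀.2 - H w₀.1) (P.reducedForcing H K u fun τ => (w τ).1)
      fun t => (w t).2 - H (w t).1 := by
  have hf : ∀ t, IntegrableOn (fun τ => P.inputOp (u τ)) (Ioc 0 t) := fun t =>
    P.inputOp.integrable_comp ((hu.integrableOn_compact_subset Icc_subset_Ici_self
      isCompact_Icc).mono_set Ioc_subset_Icc_self)
  -- Here `L` sends the input `(B₁ u, B₂ u)` to `(B₂ - H B₁) u`, so the transported forcing is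
  -- definitionally that of (R).
  have key := hw.intertwine hT hTgen hS.semigroup hS.generator
    (ContinuousLinearMap.snd ℝ Y X₂ - H.comp (ContinuousLinearMap.fst ℝ Y X₂))
    (K.comp (ContinuousLinearMap.fst ℝ Y X₂)) hK.intertwine hf
  exact key

/-- `φ` and `x₂ - H y` are mild solutions with the same forcing, so their convolution integrals
cancel. -/
theorem IsStabilizing.reduced_error_eq (hT : IsC0Semigroup T)
    (hTgen : IsGenerator P.blockOp T) (hS : P.IsStabilizing H S M α)
    (hK : P.HasBoundedCoefficient H K) (hu : LocallyIntegrableOn u (Ici 0))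
    (hw : IsMildSolution T w₀ (fun τ => P.inputOp (u τ)) w) {φ₀ : X₂} {φ : ℝ → X₂}
    (hφ : IsMildSolution S φ₀ (P.reducedForcing H K u fun τ => (w τ).1) φ) {t : ℝ}
    (ht : 0 ≤ t) : φ t + H (w t).1 - (w t).2 = S t (φ₀ + H w₀.1 - w₀.2) := by
  have h1 : (w t).2 - H (w t).1 = _ := (hS.isMildSolution_reduced hT hTgen hK hu hw t ht).2
  have h2 : φ t + H (w t).1 - (w t).2 = φ t - ((w t).2 - H (w t).1) := by abel
  have h3 : φ₀ + H w₀.1 - w₀.2 = φ₀ - (w₀.2 - H w₀.1) := by abel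
  rw [h2, h3, h1, (hφ t ht).2]
  simp only [map_sub]
  abel

theorem IsStabilizing.isReducedExpEstimator (hT : IsC0Semigroup T)
    (hTgen : IsGenerator P.blockOp T) (hS : P.IsStabilizing H S M α)
    (hK : P.HasBoundedCoefficient H K) : P.IsReducedExpEstimator T H K S M α := by
  intro u hu w₀ w hw φ₀
  -- The variation of constants formula defines `φ`; its integrand is integrable because `x₂ - H y`
  -- is already a mild solution with this forcing.
  refine ⟨⟨fun t => S t φ₀ + ∫ τ in (0 : ℝ)..t,
    S (t - τ) (P.reducedForcing H K u (fun τ => (w τ).1) τ), fun t ht =>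
      ⟨(hS.isMildSolution_reduced hT hTgen hK hu hw t ht).1, rfl⟩⟩, fun φ hφ t ht => ?_⟩
  rw [hS.reduced_error_eq hT hTgen hK hu hw hφ ht]
  exact hS.norm_apply_le ht _

end PartitionedSystem

end RegionalObs

end

theorem theorem5p12 {n p : ℕ} (Ω Γ : Set (EuclideanSpace ℝ (Fin n)))
    (hΩ_open : IsOpen Ω) (hΩ_bdd : Bornology.IsBounded Ω)
    (hΓ_sub : Γ ⊆ frontier Ω) (hΓ_meas : MeasurableSet Γ)
    (hΓ_pos : 0 < RegionalObs.surfaceMeasure Γ Set.univ)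
    (hΓ_fin : RegionalObs.surfaceMeasure Γ Set.univ < ⊤)
    {Y : Type*} [NormedAddCommGroup Y] [InnerProductSpace ℝ Y] [CompleteSpace Y]
    (P : RegionalObs.PartitionedSystem p Y (RegionalObs.SobolevHalf Γ))
    (T : ℝ → (Y × RegionalObs.SobolevHalf Γ) →L[ℝ] (Y × RegionalObs.SobolevHalf Γ))
    (hT : RegionalObs.IsC0Semigroup T) (hTgen : RegionalObs.IsGenerator P.blockOp T)
    (hdet : P.IsDetectable) :
    -- observability, through both forms of the estimator
    P.IsObservable ∧
    ((∃ (H K : Y →L[ℝ] RegionalObs.SobolevHalf Γ)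
        (S : ℝ → RegionalObs.SobolevHalf Γ →L[ℝ] RegionalObs.SobolevHalf Γ) (M α : ℝ),
        P.IsStabilizing H S M α ∧ P.HasBoundedCoefficient H K) → P.IsReducedObservable T) ∧
    -- every gain that realises detectability works, with the constants of its semigroup
    ∀ (H : Y →L[ℝ] RegionalObs.SobolevHalf Γ)
      (S : ℝ → RegionalObs.SobolevHalf Γ →L[ℝ] RegionalObs.SobolevHalf Γ) (M α : ℝ),
      P.IsStabilizing H S M α →
      P.IsExpEstimator H M α ∧
      (∀ (u : ℝ → EuclideanSpace ℝ (Fin p)) (x₁ : ℝ → Y)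
        (x₂ z : ℝ → RegionalObs.SobolevHalf Γ),
        P.IsTrajectory u x₁ x₂ → P.IsEstimate H u x₁ x₂ z →
        (∀ t : ℝ, 0 < t → ∃ h : z t - x₂ t ∈ (P.errorOp H).domain,
          HasDerivAt (fun s => z s - x₂ s) (P.errorOp H ⟨z t - x₂ t, h⟩) t) ∧
        (∀ t : ℝ, 0 ≤ t → z t - x₂ t = S t (z 0 - x₂ 0)) ∧
        Tendsto (fun t => ‖z t - x₂ t‖) atTop (𝓝 0)) ∧
      ∀ K : Y →L[ℝ] RegionalObs.SobolevHalf Γ, P.HasBoundedCoefficient H K →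
        P.IsReducedExpEstimator T H K S M α ∧
        ∀ (u : ℝ → EuclideanSpace ℝ (Fin p)), LocallyIntegrableOn u (Ici 0) →
        ∀ (w₀ : Y × RegionalObs.SobolevHalf Γ) (w : ℝ → Y × RegionalObs.SobolevHalf Γ),
          RegionalObs.IsMildSolution T w₀ (fun τ => P.inputOp (u τ)) w →
        ∀ (φ₀ : RegionalObs.SobolevHalf Γ) (φ : ℝ → RegionalObs.SobolevHalf Γ),
          RegionalObs.IsMildSolution S φ₀ (P.reducedForcing H K u fun τ => (w τ).1) φ →
          (∀ t : ℝ, 0 ≤ t → φ t + H (w t).1 - (w t).2 = S t (φ₀ + H w₀.1 - w₀.2)) ∧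
          Tendsto (fun t => ‖φ t + H (w t).1 - (w t).2‖) atTop (𝓝 0) := by
  refine ⟨?_, ?_, ?_⟩
  · obtain ⟨H, S, M, α, hS⟩ := hdet
    exact ⟨H, M, α, hS.M_pos, hS.α_pos, hS.isExpEstimator⟩
  · rintro ⟨H, K, S, M, α, hS, hK⟩
    exact ⟨H, K, S, M, α, hK, hS.semigroup, hS.generator, hS.M_pos, hS.α_pos,
      hS.isReducedExpEstimator hT hTgen hK⟩
  · intro H S M α hS
    refine ⟨hS.isExpEstimator, fun u x₁ x₂ z hx hz =>
      ⟨fun t ht => hz.hasDerivAt_error hx ht, fun t ht => hS.error_eq hx hz ht,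
        hS.tendsto_norm_zero fun t ht => hS.error_eq hx hz ht⟩, fun K hK =>
      ⟨hS.isReducedExpEstimator hT hTgen hK, fun u hu w₀ w hw φ₀ φ hφ =>
        ⟨fun t ht => hS.reduced_error_eq hT hTgen hK hu hw hφ ht,
          hS.tendsto_norm_zero fun t ht => hS.reduced_error_eq hT hTgen hK hu hw hφ ht⟩⟩⟩
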